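/- For metric spaces $U,V$ with at least two points and a one-to-one map $f:U\to V$ let $$\mathrm{dist}(f)=\sup_{x\neq y}\frac{d_V(f(x),f(y))}{d_U(x,y)}\cdot\sup_{a\neq b}\frac{d_U(a,b)}{d_V(f(a),f(b))}\in[1,\infty],$$ and let $\mathrm{dist}(f)=\infty$ if $f$ is not one-to-one. For $p\in[2,\infty)$ and a finite metric space $X$ with at least two points, let $\mathsf{c}_p(X)$ be the infimum of $\mathrm{dist}(f)$ over all $f:X\to\ell_p$, where $\ell_p$ is the space of $p$-summable real sequences. For $\alpha>1$ let $p_\alpha(X)$ be the infimum of those $p\in[2,\infty)$ for which $\mathsf{c}_p(X)<\alpha$, and put $p(X)=p_{10}(X)$. For positive integers $m,n$ let $[m]_\infty^n$ be the grid $\{1,\ldots,m\}^n\subset\mathbb{R}^n$ with the $\ell_\infty$ metric. Write $Q\asymp Q'$ if $cQ'\le Q\le KQ'$ for some universal constants $c,K>0$. **Corollary 1.9.** 1. There exists $m_0\in\mathbb{N}$ such that $p([m]_\infty^n)\asymp\log n$ for all integers $m\ge m_0$ and $n\ge 2$. 2. More generally, there exists a universal constant $C\ge 1$ such that for every real $\alpha\ge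 2$ and all positive integers $m,n$ with $m\ge C\alpha$, $$p_\alpha([m]_\infty^n)\asymp\max\Big\{1,\frac{\log n}{\log\alpha}\Big\};$$ in particular $p_\alpha([m]_\infty^n)\asymp\frac{\log n}{\log\alpha}$ whenever $n\ge\alpha$. 3. Consequently, for every $D\ge 1$ there are $m_1=m_1(D)\in\mathbb{N}$ and $c=c(D)>0$, independent of $n$ and $p$, such that for all integers $m\ge m_1$ and $n\ge 1$ and every $p\in[2,\infty)$, if $\mathsf{c}_p([m]_\infty^n)\le D$ then $p\ge c\log n$. -/

import Mathlib

open scoped ENNReal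

/-- The bi-Lipschitz distortion of a map between metric spaces, with values in `[0, ∞]`:
the product of the Lipschitz constants of `f` and of its inverse if `f` is one-to-one,
and `∞` if `f` is not one-to-one. -/
noncomputable def distortion {U V : Type*} [MetricSpace U] [MetricSpace V] (f : U → V) : ℝ≥0∞ :=
  open Classical in
  if Function.Injective f then
    (⨆ (x : U) (y : U) (_ : x ≠ y), edist (f x) (f y) / edist x y) *
      (⨆ (a : U) (b : U) (_ : a ≠ b), edist a b / edist (f a) (f b))
  else ∞

/-- The distortion of `U` in `V`: the infimum of the distortions of all maps `U → V`. -/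
noncomputable def spaceDistortion (U V : Type*) [MetricSpace U] [MetricSpace V] : ℝ≥0∞ :=
  ⨅ f : U → V, distortion f

theorem one_le_ofReal_of_two_le {p : ℝ} (hp : 2 ≤ p) : 1 ≤ ENNReal.ofReal p := by
  rw [ENNReal.one_le_ofReal]
  linarith

/-- The distortion of `X` in the Banach space `ℓ_p` of real sequences, for real `p ≥ 2`. -/
noncomputable def ellpDistortion (p : ℝ) (hp : 2 ≤ p) (X : Type*) [MetricSpace X] : ℝ≥0∞ :=
  haveI : Fact (1 ≤ ENNReal.ofReal p) := ⟨one_le_ofReal_of_two_le hp⟩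
  spaceDistortion X (lp (fun _ : ℕ => ℝ) (ENNReal.ofReal p))

/-- `p_α(X)`: the infimum of those `p ∈ [2, ∞)` for which the distortion of `X` in `ℓ_p`
is smaller than `α`. -/
noncomputable def pIndex (α : ℝ) (X : Type*) [MetricSpace X] : ℝ :=
  sInf {p : ℝ | ∃ hp : 2 ≤ p, ellpDistortion p hp X < ENNReal.ofReal α}

/-- The grid `{1, …, m}ⁿ ⊆ ℝⁿ`. Its metric is the restriction of that of `Fin n → ℝ`,
which is the `ℓ_∞` metric. -/
def linftyGrid (m n : ℕ) : Set (Fin n → ℝ) :=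
  {x | ∀ i, ∃ k : ℕ, 1 ≤ k ∧ k ≤ m ∧ x i = (k : ℝ)}

/-! Upper bound: the inclusion of the grid into `ℓ_p^n` has distortion at most `n^(1/p)`, which is
below `α` once `p > log n / log α`. Lower bound: a metric cotype inequality. Clarkson's inequality
makes the iterated averages of a map `g` on a finite abelian group behave like a martingale in a
space of cotype `p`: the `p`-th powers of its differences have a sum controlled by the oscillation
`L` of `g` under signed sums of the directions (`martingaleDifferenceSum_add_le`). Hence the
displacements of `g` under `2k` steps in each of `n` directions have total `p`-th power at most
`(4L)^p (n + k^p)` per point (`sum_powSum_translate_sub_le`). The torus `(ℤ/4k)^n` folds onto a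
subgrid by a map that is 1-Lipschitz under such signed sums, while a half-turn in one coordinate
typically displaces points by order `k`. Composing with an embedding of distortion below `α` gives
`n k^p ≤ (8α)^p (n + k^p)`; for `k ≥ 16α` the term in `n` is absorbed, so `n ≤ (16α)^p`. -/

theorem add_rpow_le_two_rpow_mul {p a b : ℝ} (ha : 0 ≤ a) (hb : 0 ≤ b) (hp : 1 ≤ p) :
    (a + b) ^ p ≤ 2 ^ (p - 1) * (a ^ p + b ^ p) := by
  lift a to NNReal using ha
  lift b to NNReal using hb
  exact_mod_cast NNReal.rpow_add_le_mul_rpow_add_rpow a b hp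

/-! ### Unnormalised `L_p` sums on a finite group -/

section PowSum

variable {G V : Type*} [Fintype G] [NormedAddCommGroup V]

/-- The `p`-th power of the `L_p` norm with respect to the counting measure. -/
noncomputable def powSum (p : ℝ) (g : G → V) : ℝ := ∑ x, ‖g x‖ ^ p

theorem powSum_translate [AddCommGroup G] (p : ℝ) (g : G → V) (e : G) :
    powSum p (fun x => g (x + e)) = powSum p g :=
  Fintype.sum_equiv (Equiv.addRight e) _ _ fun _ => rfl

theorem powSum_nonneg (p : ℝ) (g : G → V) : 0 ≤ powSum p g :=
  Finset.sum_nonneg fun _ _ => Real.rpow_nonneg (norm_nonneg _) _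

end PowSum

/-! ### Martingale and metric cotype -/

section DirectionalCotype

variable {G V : Type*} [AddCommGroup G]

/-- All sums `∑ εᵢ eᵢ` with `εᵢ ∈ {-1, 0, 1}`, where `e₁, e₂, …` are the entries of a list. -/
def signedSubsums : List G → Set G
  | [] => {0}
  | e :: l => {s | ∃ t ∈ signedSubsums l, s = t ∨ s = t + e ∨ s = t - e}

theorem signedSubsums_subset_cons (e : G) (l : List G) :
    signedSubsums l ⊆ signedSubsums (e :: l) :=
  fun t ht => ⟨t, ht, Or.inl rfl⟩

theorem zero_mem_signedSubsums : ∀ l : List G, (0 : G) ∈ signedSubsums l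
  | [] => rfl
  | e :: l => signedSubsums_subset_cons e l (zero_mem_signedSubsums l)

/-- Distinct basis vectors never add up in one coordinate, so a signed sum of them is a single `ℓ_∞`
step. -/
theorem signedSubsums_single_apply {n : ℕ} {R : Type*} [Ring R] :
    ∀ (l : List (Fin n)), l.Nodup → ∀ s ∈ signedSubsums (l.map fun i => (Pi.single i 1 : Fin n → R)),
      ∀ i, (s i = 0 ∨ s i = 1 ∨ s i = -1) ∧ (i ∉ l → s i = 0)
  | [], _, s, hs, i => by
    have hs' : s = 0 := hs
    simp [hs']
  | j :: l, hl, s, hs, i => by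
    obtain ⟨t, ht, hst⟩ := hs
    have hjl := (List.nodup_cons.1 hl).1
    have ih := signedSubsums_single_apply l (List.nodup_cons.1 hl).2 t ht
    have hi := ih i
    have hj := (ih j).2 hjl
    by_cases hij : i = j
    · subst hij
      rcases hst with rfl | rfl | rfl <;> simp [hj]
    · rcases hst with rfl | rfl | rfl <;> simp [hij, hi.1] <;> exact hi.2

variable [NormedAddCommGroup V] [NormedSpace ℝ V]

/-- The average of a function over the two translates by `e` and `-e`. -/
noncomputable def dirAverage (e : G) (g : G → V) (x : G) : V :=
  (2⁻¹ : ℝ) • (g (x + e) + g (x - e))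

/-- Half of the symmetric difference of a function in direction `e`. -/
noncomputable def dirDifference (e : G) (g : G → V) (x : G) : V :=
  (2⁻¹ : ℝ) • (g (x + e) - g (x - e))

/-- The composition of the averages in the directions of a list. -/
noncomputable def listAverage : List G → (G → V) → G → V
  | [], g => g
  | e :: l, g => dirAverage e (listAverage l g)

/-- The iterated average is a convex combination of translates `g (x + s)`, and balls are convex. -/
theorem norm_listAverage_sub_le (g : G → V) (v : V) (L : ℝ) :
    ∀ (l : List G) (x : G), (∀ s ∈ signedSubsums l, ‖g (x + s) - v‖ ≤ L) →
      ‖listAverage l g x - v‖ ≤ L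
  | [], x, h => by simpa [listAverage] using h 0 (zero_mem_signedSubsums [])
  | e :: l, x, h => by
    have h₁ := norm_listAverage_sub_le g v L l (x + e) fun s hs => by
      have := h (s + e) ⟨s, hs, Or.inr (Or.inl rfl)⟩
      rwa [show x + (s + e) = x + e + s by abel] at this
    have h₂ := norm_listAverage_sub_le g v L l (x - e) fun s hs => by
      have := h (s - e) ⟨s, hs, Or.inr (Or.inr rfl)⟩
      rwa [show x + (s - e) = x - e + s by abel] at this
    have key : listAverage (e :: l) g x - v = (2⁻¹ : ℝ) •
        ((listAverage l g (x + e) - v) + (listAverage l g (x - e) - v)) := by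
      simp only [listAverage, dirAverage]
      module
    rw [key, norm_smul]
    have := norm_add_le (listAverage l g (x + e) - v) (listAverage l g (x - e) - v)
    norm_num
    linarith

variable [Fintype G]

/-- The sum of the `p`-th powers of the norms of the successive differences of the martingale
of iterated averages. -/
noncomputable def martingaleDifferenceSum (p : ℝ) : List G → (G → V) → ℝ
  | [], _ => 0
  | e :: l, g => powSum p (dirDifference e (listAverage l g)) + martingaleDifferenceSum p l g

/-- Martingale cotype for iterated averages, under Clarkson's inequality with exponent `p`. -/
theorem martingaleDifferenceSum_add_le {p : ℝ}
    (hV : ∀ a b : V, 2 * (‖a‖ ^ p + ‖b‖ ^ p) ≤ ‖a + b‖ ^ p + ‖a - b‖ ^ p) (g : G → V) (B : ℝ) :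
    ∀ (l : List G) (u : G → V),
      (∀ s ∈ signedSubsums l, powSum p (fun x => g (x + s) - u x) ≤ B) →
      martingaleDifferenceSum p l g + powSum p (fun x => listAverage l g x - u x) ≤ B
  | [], u, h => by
    simpa [martingaleDifferenceSum, listAverage] using h 0 (zero_mem_signedSubsums [])
  | e :: l, u, h => by
    -- The comparison function is shifted the opposite way, so that after translation both bounds
    -- compare with the same `u x`.
    have h₁ := martingaleDifferenceSum_add_le hV g B l (fun x => u (x - e)) fun s hs => by
      refine le_of_eq_of_le ?_ (h (s + e) ⟨s, hs, Or.inr (Or.inl rfl)⟩)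
      rw [← powSum_translate p (fun x => g (x + s) - u (x - e)) e]
      simp only [add_sub_cancel_right]
      congr! 4
      abel
    have h₂ := martingaleDifferenceSum_add_le hV g B l (fun x => u (x + e)) fun s hs => by
      refine le_of_eq_of_le ?_ (h (s - e) ⟨s, hs, Or.inr (Or.inr rfl)⟩)
      rw [← powSum_translate p (fun x => g (x + s) - u (x + e)) (-e)]
      simp only [neg_add_cancel_right]
      congr! 4
      abel
    rw [← powSum_translate p (fun x => listAverage l g x - u (x - e)) e] at h₁
    rw [← powSum_translate p (fun x => listAverage l g x - u (x + e)) (-e)] at h₂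
    simp only [add_sub_cancel_right] at h₁
    simp only [← sub_eq_add_neg, sub_add_cancel] at h₂
    -- Clarkson with `a` the new average minus `u` and `b` the new difference: `a ± b` are the old
    -- average at `x ± e` minus `u x`.
    have key : 2 * (powSum p (fun x => listAverage (e :: l) g x - u x) +
        powSum p (dirDifference e (listAverage l g))) ≤
        powSum p (fun x => listAverage l g (x + e) - u x) +
        powSum p (fun x => listAverage l g (x - e) - u x) := by
      simp only [powSum, ← Finset.sum_add_distrib, Finset.mul_sum]
      refine Finset.sum_le_sum fun x _ => (hV _ _).trans_eq ?_
      simp only [listAverage, dirAverage, dirDifference]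
      congr! 3 <;> module
    simp only [martingaleDifferenceSum]
    linarith

/-- Telescoping into `k` steps of length `2e` costs `k^(p-1)` by convexity; by translation
invariance all steps contribute equally. -/
theorem powSum_translate_sub_le {p : ℝ} (hp : 1 ≤ p) (h : G → V) (e : G) (k : ℕ) :
    powSum p (fun x => h (x + (2 * k) • e) - h x) ≤
      (2 * k : ℝ) ^ p * powSum p (dirDifference e h) := by
  have hstep : ∀ t : ℕ, powSum p (fun x => h (x + (2 * (t + 1)) • e) - h (x + (2 * t) • e)) =
      2 ^ p * powSum p (dirDifference e h) := by
    intro t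
    rw [← powSum_translate p (dirDifference e h) ((2 * t + 1) • e)]
    simp only [powSum, Finset.mul_sum]
    refine Finset.sum_congr rfl fun x _ => ?_
    rw [← Real.mul_rpow (by norm_num) (norm_nonneg _), dirDifference, norm_smul,
      show x + (2 * t + 1) • e + e = x + (2 * (t + 1)) • e by
        simp only [mul_add, add_smul, mul_smul, one_smul, two_smul]; abel,
      show x + (2 * t + 1) • e - e = x + (2 * t) • e by
        simp only [add_smul, mul_smul, one_smul, two_smul]; abel]
    norm_num [← mul_assoc]
  have hpt : ∀ x, ‖h (x + (2 * k) • e) - h x‖ ^ p ≤ (k : ℝ) ^ (p - 1) *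
      ∑ t ∈ Finset.range k, ‖h (x + (2 * (t + 1)) • e) - h (x + (2 * t) • e)‖ ^ p := by
    intro x
    have hsum : h (x + (2 * k) • e) - h x =
        ∑ t ∈ Finset.range k, (h (x + (2 * (t + 1)) • e) - h (x + (2 * t) • e)) := by
      rw [Finset.sum_range_sub fun t => h (x + (2 * t) • e)]
      simp
    have hJ := Real.rpow_sum_le_const_mul_sum_rpow (Finset.range k)
      (fun t => ‖h (x + (2 * (t + 1)) • e) - h (x + (2 * t) • e)‖) hp
    simp only [abs_norm, Finset.card_range] at hJ
    rw [hsum]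
    exact (Real.rpow_le_rpow (norm_nonneg _) (norm_sum_le _ _) (by linarith)).trans hJ
  calc powSum p (fun x => h (x + (2 * k) • e) - h x)
      ≤ ∑ x, (k : ℝ) ^ (p - 1) *
          ∑ t ∈ Finset.range k, ‖h (x + (2 * (t + 1)) • e) - h (x + (2 * t) • e)‖ ^ p :=
        Finset.sum_le_sum fun x _ => hpt x
    _ = (k : ℝ) ^ (p - 1) * ∑ t ∈ Finset.range k,
          powSum p (fun x => h (x + (2 * (t + 1)) • e) - h (x + (2 * t) • e)) := by
        rw [← Finset.mul_sum, Finset.sum_comm]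
        rfl
    _ = (k : ℝ) ^ (p - 1) * k * (2 ^ p * powSum p (dirDifference e h)) := by
        simp only [hstep, Finset.sum_const, Finset.card_range, nsmul_eq_mul]
        ring
    _ = (2 * k : ℝ) ^ p * powSum p (dirDifference e h) := by
        rcases Nat.eq_zero_or_pos k with rfl | hk
        · simp [Real.zero_rpow (show p ≠ 0 by linarith)]
        · have hk' : (0 : ℝ) < k := by exact_mod_cast hk
          rw [Real.mul_rpow (by norm_num) hk'.le, ← Real.rpow_add_one hk'.ne', sub_add_cancel]
          ring

/-- For each `e`, `g` is replaced by its average over the later directions, at a cost of `L` at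
either end; the `e`-difference of that average is exactly a martingale difference. -/
theorem sum_powSum_translate_sub_le_aux {p L : ℝ} (hp : 1 ≤ p) (hL : 0 ≤ L) (g : G → V) (k : ℕ) :
    ∀ l : List G, (∀ s ∈ signedSubsums l, ∀ x, ‖g (x + s) - g x‖ ≤ L) →
      (l.map fun e => powSum p (fun x => g (x + (2 * k) • e) - g x)).sum ≤
        2 ^ (p - 1) * (l.length * ((2 * L) ^ p * Fintype.card G) +
          (2 * k : ℝ) ^ p * martingaleDifferenceSum p l g)
  | [], _ => by simp [martingaleDifferenceSum]
  | e :: l, h => by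
    have hl : ∀ s ∈ signedSubsums l, ∀ x, ‖g (x + s) - g x‖ ≤ L :=
      fun s hs => h s (signedSubsums_subset_cons e l hs)
    have ih := sum_powSum_translate_sub_le_aux hp hL g k l hl
    set a := listAverage l g with ha
    have hclose : ∀ x, ‖a x - g x‖ ≤ L := fun x =>
      norm_listAverage_sub_le g (g x) L l x fun s hs => hl s hs x
    have hpt : ∀ x, ‖g (x + (2 * k) • e) - g x‖ ^ p ≤
        2 ^ (p - 1) * ((2 * L) ^ p + ‖a (x + (2 * k) • e) - a x‖ ^ p) := by
      intro x
      have htri : ‖g (x + (2 * k) • e) - g x‖ ≤ 2 * L + ‖a (x + (2 * k) • e) - a x‖ := by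
        have h₁ := hclose x
        have h₂ := hclose (x + (2 * k) • e)
        have h₃ : g (x + (2 * k) • e) - g x = (a x - g x) - (a (x + (2 * k) • e) -
          g (x + (2 * k) • e)) + (a (x + (2 * k) • e) - a x) := by abel
        rw [h₃]
        refine (norm_add_le _ _).trans ?_
        have := norm_sub_le (a x - g x) (a (x + (2 * k) • e) - g (x + (2 * k) • e))
        linarith
      exact (Real.rpow_le_rpow (norm_nonneg _) htri (by linarith)).trans
        (add_rpow_le_two_rpow_mul (by positivity) (norm_nonneg _) hp)
    have hstep : powSum p (fun x => g (x + (2 * k) • e) - g x) ≤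
        2 ^ (p - 1) * ((2 * L) ^ p * Fintype.card G +
          (2 * k : ℝ) ^ p * powSum p (dirDifference e a)) := by
      calc powSum p (fun x => g (x + (2 * k) • e) - g x)
          ≤ ∑ x, 2 ^ (p - 1) * ((2 * L) ^ p + ‖a (x + (2 * k) • e) - a x‖ ^ p) :=
            Finset.sum_le_sum fun x _ => hpt x
        _ = 2 ^ (p - 1) * ((2 * L) ^ p * Fintype.card G +
              powSum p (fun x => a (x + (2 * k) • e) - a x)) := by
            rw [← Finset.mul_sum, Finset.sum_add_distrib]
            simp [powSum, mul_comm]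
        _ ≤ _ := by
            gcongr
            exact powSum_translate_sub_le hp a e k
    simp only [List.map_cons, List.sum_cons, List.length_cons, martingaleDifferenceSum, ← ha]
    push_cast
    linarith

/-- Metric cotype inequality for Lipschitz maps on a finite abelian group. -/
theorem sum_powSum_translate_sub_le {p L : ℝ} (hp : 1 ≤ p) (hL : 0 ≤ L)
    (hV : ∀ a b : V, 2 * (‖a‖ ^ p + ‖b‖ ^ p) ≤ ‖a + b‖ ^ p + ‖a - b‖ ^ p) (g : G → V) (k : ℕ)
    (l : List G) (h : ∀ s ∈ signedSubsums l, ∀ x, ‖g (x + s) - g x‖ ≤ L) :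
    (l.map fun e => powSum p (fun x => g (x + (2 * k) • e) - g x)).sum ≤
      (4 * L) ^ p * (l.length + (k : ℝ) ^ p) * Fintype.card G := by
  have h₁ := sum_powSum_translate_sub_le_aux hp hL g k l h
  have h₂ := martingaleDifferenceSum_add_le hV g (L ^ p * Fintype.card G) l g fun s hs => by
    refine (Finset.sum_le_sum fun x _ =>
      Real.rpow_le_rpow (norm_nonneg _) (h s hs x) (by linarith)).trans_eq ?_
    simp [mul_comm]
  have h₃ := powSum_nonneg p (fun x => listAverage l g x - g x)
  have h₄ : martingaleDifferenceSum p l g ≤ L ^ p * Fintype.card G := by linarith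
  refine h₁.trans ?_
  have h₅ : (2 : ℝ) ^ (p - 1) ≤ 2 ^ p := Real.rpow_le_rpow_of_exponent_le one_le_two (by linarith)
  have h₆ : (4 * L) ^ p = 2 ^ p * (2 ^ p * L ^ p) := by
    rw [← Real.mul_rpow two_pos.le hL, ← Real.mul_rpow two_pos.le (by positivity)]
    ring_nf
  calc _ ≤ 2 ^ p * (l.length * ((2 * L) ^ p * Fintype.card G) +
          (2 * k : ℝ) ^ p * (L ^ p * Fintype.card G)) := by
        refine (mul_le_mul_of_nonneg_left (add_le_add_right (mul_le_mul_of_nonneg_left h₄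
          (by positivity)) _) (by positivity)).trans ?_
        gcongr
    _ = _ := by
        rw [h₆, Real.mul_rpow two_pos.le hL, Real.mul_rpow two_pos.le k.cast_nonneg]
        ring

end DirectionalCotype

/-! ### Clarkson's inequality in `ℓ_p` -/

section Clarkson

/-- Superadditivity of `t ↦ t^(p/2)`, then its convexity together with the parallelogram identity.
-/
theorem two_mul_abs_rpow_add_le {p : ℝ} (hp : 2 ≤ p) (a b : ℝ) :
    2 * (|a| ^ p + |b| ^ p) ≤ |a + b| ^ p + |a - b| ^ p := by
  have hsq : ∀ c : ℝ, |c| ^ p = (c ^ 2) ^ (p / 2) := fun c => by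
    rw [← sq_abs, ← Real.rpow_natCast, ← Real.rpow_mul (abs_nonneg c)]
    congr 1
    push_cast
    ring
  have hp' : 1 ≤ p / 2 := by linarith
  have h₁ : (a ^ 2) ^ (p / 2) + (b ^ 2) ^ (p / 2) ≤ (a ^ 2 + b ^ 2) ^ (p / 2) :=
    Real.add_rpow_le_rpow_add (sq_nonneg a) (sq_nonneg b) hp'
  have h₂ := (convexOn_rpow hp').2 (Set.mem_Ici.2 (sq_nonneg (a + b)))
    (Set.mem_Ici.2 (sq_nonneg (a - b))) (show (0 : ℝ) ≤ 1 / 2 by norm_num)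
    (show (0 : ℝ) ≤ 1 / 2 by norm_num) (by norm_num)
  simp only [smul_eq_mul] at h₂
  rw [show 1 / 2 * (a + b) ^ 2 + 1 / 2 * (a - b) ^ 2 = a ^ 2 + b ^ 2 by ring] at h₂
  simp only [hsq]
  linarith

theorem lp_clarkson {ι : Type*} {p : ℝ} (hp : 2 ≤ p)
    (a b : lp (fun _ : ι => ℝ) (ENNReal.ofReal p)) :
    2 * (‖a‖ ^ p + ‖b‖ ^ p) ≤ ‖a + b‖ ^ p + ‖a - b‖ ^ p := by
  have ht : (ENNReal.ofReal p).toReal = p := ENNReal.toReal_ofReal (by linarith)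
  have hpos : 0 < (ENNReal.ofReal p).toReal := by rw [ht]; linarith
  have hn : ∀ f : lp (fun _ : ι => ℝ) (ENNReal.ofReal p), HasSum (fun i => |f i| ^ p) (‖f‖ ^ p) :=
    fun f => by simpa only [ht, Real.norm_eq_abs] using lp.hasSum_norm hpos f
  exact hasSum_le (fun i => two_mul_abs_rpow_add_le hp (a i) (b i))
    (((hn a).add (hn b)).mul_left 2) ((hn (a + b)).add (hn (a - b)))

end Clarkson

/-! ### Folding a cycle onto an interval -/

section Fold

/-- The folding map of a cycle of length `4 k` onto `{0, …, 2 k}`. -/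
def cycleFold (k : ℕ) (x : ZMod (4 * k)) : ℤ := |2 * (k : ℤ) - (x.val : ℤ)|

variable {k : ℕ}

theorem cycleFold_nonneg (x : ZMod (4 * k)) : 0 ≤ cycleFold k x := abs_nonneg _

variable [NeZero (4 * k)]

theorem val_lt_four_mul (x : ZMod (4 * k)) : x.val < 4 * k := x.val_lt

theorem cycleFold_le (x : ZMod (4 * k)) : cycleFold k x ≤ 2 * k := by
  have := val_lt_four_mul x
  rw [cycleFold, abs_le]
  omega

theorem val_add_natCast (x : ZMod (4 * k)) {j : ℕ} (hj : j < 4 * k) :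
    (x + (j : ZMod (4 * k))).val = x.val + j ∨
      (x + (j : ZMod (4 * k))).val + 4 * k = x.val + j := by
  have hx := val_lt_four_mul x
  rw [ZMod.val_add, ZMod.val_natCast_of_lt hj]
  rcases lt_or_ge (x.val + j) (4 * k) with h | h
  · exact Or.inl (Nat.mod_eq_of_lt h)
  · right
    rw [Nat.mod_eq_sub_mod h, Nat.mod_eq_of_lt (by omega)]
    omega

theorem abs_cycleFold_add_one_sub_le (hk : 0 < k) (x : ZMod (4 * k)) :
    |cycleFold k (x + 1) - cycleFold k x| ≤ 1 := by
  have h := val_add_natCast x (j := 1) (by omega)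
  have h₁ := val_lt_four_mul x
  have h₂ := val_lt_four_mul (x + 1)
  rw [Nat.cast_one] at h
  simp only [cycleFold]
  grind

theorem abs_cycleFold_add_sub_le (hk : 0 < k) (x : ZMod (4 * k)) {s : ZMod (4 * k)}
    (hs : s = 0 ∨ s = 1 ∨ s = -1) : |cycleFold k (x + s) - cycleFold k x| ≤ 1 := by
  rcases hs with rfl | rfl | rfl
  · simp
  · exact abs_cycleFold_add_one_sub_le hk x
  · have := abs_cycleFold_add_one_sub_le hk (x + -1)
    rwa [neg_add_cancel_right, abs_sub_comm] at this

theorem cycleFold_add_two_mul (hk : 0 < k) (x : ZMod (4 * k)) :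
    cycleFold k (x + ((2 * k : ℕ) : ZMod (4 * k))) = 2 * k - cycleFold k x := by
  have h := val_add_natCast x (j := 2 * k) (by omega)
  have h₁ := val_lt_four_mul x
  have h₂ := val_lt_four_mul (x + ((2 * k : ℕ) : ZMod (4 * k)))
  simp only [cycleFold]
  grind

/-- The half-turn reflects the interval and moves only points near its middle by less than `k`; a
quarter-turn takes those points towards the ends. -/
theorem le_abs_cycleFold_or (hk : 0 < k) (x : ZMod (4 * k)) :
    (k : ℤ) ≤ |2 * k - 2 * cycleFold k x| ∨
      (k : ℤ) ≤ |2 * k - 2 * cycleFold k (x + (k : ZMod (4 * k)))| := by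
  have h := val_add_natCast x (j := k) (by omega)
  have h₁ := val_lt_four_mul x
  simp only [cycleFold]
  grind

end Fold

/-! ### Cotype applied to the folded torus -/

section GridLowerBound

variable {k m n : ℕ}

/-- The fold of the discrete torus onto a subgrid of `linftyGrid m n`. -/
noncomputable def torusFold [NeZero (4 * k)] (hkm : 2 * k + 1 ≤ m) (x : Fin n → ZMod (4 * k)) :
    linftyGrid m n :=
  ⟨fun i => (cycleFold k (x i) : ℝ) + 1, fun i => by
    obtain ⟨j, hj⟩ := Int.eq_ofNat_of_zero_le (cycleFold_nonneg (x i))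
    have := cycleFold_le (x i)
    exact ⟨j + 1, by omega, by omega, by simp [hj]⟩⟩

theorem dist_torusFold_add_le [NeZero (4 * k)] (hk : 0 < k) (hkm : 2 * k + 1 ≤ m)
    (x s : Fin n → ZMod (4 * k)) (hs : ∀ i, s i = 0 ∨ s i = 1 ∨ s i = -1) :
    dist (torusFold hkm (x + s)) (torusFold hkm x) ≤ 1 := by
  rw [Subtype.dist_eq, dist_pi_le_iff zero_le_one]
  intro i
  have h := abs_cycleFold_add_sub_le hk (x i) (hs i)
  rw [Real.dist_eq]
  simp only [torusFold, add_sub_add_right_eq_sub, Pi.add_apply]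
  exact_mod_cast h

theorem add_nsmul_single_apply {ι R : Type*} [DecidableEq ι] [Ring R] (x : ι → R) (j : ℕ) (i : ι) :
    (x + j • (Pi.single i 1 : ι → R)) i = x i + (j : R) := by
  rw [Pi.add_apply, Pi.smul_apply, Pi.single_eq_same, nsmul_eq_mul, mul_one]

theorem abs_le_dist_torusFold [NeZero (4 * k)] (hk : 0 < k) (hkm : 2 * k + 1 ≤ m)
    (x : Fin n → ZMod (4 * k)) (i : Fin n) :
    ((|2 * k - 2 * cycleFold k (x i)| : ℤ) : ℝ) ≤
      dist (torusFold hkm (x + (2 * k) • Pi.single i 1)) (torusFold hkm x) := by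
  refine le_trans (le_of_eq ?_) (dist_le_pi_dist _ _ i)
  rw [Real.dist_eq]
  simp only [torusFold, add_sub_add_right_eq_sub]
  rw [add_nsmul_single_apply, cycleFold_add_two_mul hk]
  push_cast
  congr 1
  ring

variable {V : Type*} [NormedAddCommGroup V] [NormedSpace ℝ V]

theorem grid_rpow_le {p A B : ℝ} (hp : 1 ≤ p)
    (hV : ∀ a b : V, 2 * (‖a‖ ^ p + ‖b‖ ^ p) ≤ ‖a + b‖ ^ p + ‖a - b‖ ^ p)
    (hk : 0 < k) (hkm : 2 * k + 1 ≤ m) (hA : 0 ≤ A) (hB : 0 ≤ B) (f : linftyGrid m n → V)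
    (hfA : ∀ x y, dist (f x) (f y) ≤ A * dist x y)
    (hfB : ∀ x y, dist x y ≤ B * dist (f x) (f y)) :
    n * (k : ℝ) ^ p ≤ (8 * (A * B)) ^ p * (n + (k : ℝ) ^ p) := by
  have : NeZero (4 * k) := ⟨by omega⟩
  have hp0 : 0 ≤ p := by linarith
  set g : (Fin n → ZMod (4 * k)) → V := fun x => f (torusFold hkm x) with hg
  have hcard : (0 : ℝ) < Fintype.card (Fin n → ZMod (4 * k)) := by
    exact_mod_cast Fintype.card_pos
  have hupper := sum_powSum_translate_sub_le hp hA hV g k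
    ((List.finRange n).map fun i => Pi.single i 1) fun s hs x => by
      rw [← dist_eq_norm]
      refine (hfA _ _).trans (mul_le_of_le_one_right hA (dist_torusFold_add_le hk hkm x s fun i =>
        (signedSubsums_single_apply _ (List.nodup_finRange n) s hs i).1))
  have hlower : ∀ i : Fin n, Fintype.card (Fin n → ZMod (4 * k)) * (k : ℝ) ^ p ≤
      2 * (B ^ p * powSum p (fun x => g (x + (2 * k) • Pi.single i 1) - g x)) := by
    intro i
    set e : Fin n → ZMod (4 * k) := Pi.single i 1 with he
    have hpt : ∀ x, ((|2 * k - 2 * cycleFold k (x i)| : ℤ) : ℝ) ^ p ≤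
        B ^ p * ‖g (x + (2 * k) • e) - g x‖ ^ p := by
      intro x
      rw [← Real.mul_rpow hB (norm_nonneg _), ← dist_eq_norm]
      exact Real.rpow_le_rpow (by positivity)
        ((abs_le_dist_torusFold hk hkm x i).trans (hfB _ _)) hp0
    -- Pairing `x` with its quarter-turn costs a factor 2 on summing over the torus.
    have hpair : ∀ x : Fin n → ZMod (4 * k), (k : ℝ) ^ p ≤
        ((|2 * k - 2 * cycleFold k (x i)| : ℤ) : ℝ) ^ p +
        ((|2 * k - 2 * cycleFold k ((x + k • e) i)| : ℤ) : ℝ) ^ p := by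
      intro x
      have hk0 : (0 : ℝ) ≤ k := k.cast_nonneg
      have hcast : ∀ z : ℤ, (k : ℤ) ≤ z → (k : ℝ) ≤ z := fun z hz => by exact_mod_cast hz
      have h := le_abs_cycleFold_or hk (x i)
      rw [he, add_nsmul_single_apply]
      rcases h with h | h
      · have h' := Real.rpow_le_rpow hk0 (hcast _ h) hp0
        exact h'.trans (le_add_of_nonneg_right (Real.rpow_nonneg (by positivity) _))
      · have h' := Real.rpow_le_rpow hk0 (hcast _ h) hp0
        exact h'.trans (le_add_of_nonneg_left (Real.rpow_nonneg (by positivity) _))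
    calc Fintype.card (Fin n → ZMod (4 * k)) * (k : ℝ) ^ p
        = ∑ _x : Fin n → ZMod (4 * k), (k : ℝ) ^ p := by simp
      _ ≤ ∑ x, (B ^ p * ‖g (x + (2 * k) • e) - g x‖ ^ p +
            B ^ p * ‖g (x + k • e + (2 * k) • e) -
              g (x + k • e)‖ ^ p) :=
          Finset.sum_le_sum fun x _ => (hpair x).trans (add_le_add (hpt x) (hpt _))
      _ = B ^ p * powSum p (fun x => g (x + (2 * k) • e) - g x) + B ^ p *
            powSum p (fun x => g (x + k • e + (2 * k) • e) - g (x + k • e)) := by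
          rw [Finset.sum_add_distrib, ← Finset.mul_sum, ← Finset.mul_sum, powSum, powSum]
      _ = 2 * (B ^ p * powSum p (fun x => g (x + (2 * k) • e) - g x)) := by
          rw [powSum_translate p (fun x => g (x + (2 * k) • e) - g x) (k • e)]
          ring
  have hsum : n * (Fintype.card (Fin n → ZMod (4 * k)) * (k : ℝ) ^ p) ≤ 2 * (B ^ p *
      ∑ i : Fin n, powSum p (fun x => g (x + (2 * k) • Pi.single i 1) - g x)) := by
    rw [Finset.mul_sum, Finset.mul_sum]
    refine le_trans (by simp) (Finset.sum_le_sum fun i _ => hlower i)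
  rw [List.map_map, List.length_map, List.length_finRange, ← List.ofFn_eq_map,
    List.sum_ofFn] at hupper
  have htwo : (2 : ℝ) ≤ 2 ^ p := Real.self_le_rpow_of_one_le one_le_two hp
  refine le_of_mul_le_mul_right ?_ hcard
  calc n * (k : ℝ) ^ p * Fintype.card (Fin n → ZMod (4 * k))
      = n * (Fintype.card (Fin n → ZMod (4 * k)) * (k : ℝ) ^ p) := by ring
    _ ≤ 2 * (B ^ p * ((4 * A) ^ p * (n + (k : ℝ) ^ p) *
          Fintype.card (Fin n → ZMod (4 * k)))) := by
        refine hsum.trans ?_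
        gcongr
        exact hupper
    _ ≤ 2 ^ p * (B ^ p * ((4 * A) ^ p * (n + (k : ℝ) ^ p) *
          Fintype.card (Fin n → ZMod (4 * k)))) := by
        gcongr
    _ = _ := by
        rw [show 8 * (A * B) = 2 * (B * (4 * A)) by ring, Real.mul_rpow two_pos.le (by positivity),
          Real.mul_rpow hB (by positivity)]
        ring

end GridLowerBound

/-! ### Distortion and Lipschitz constants -/

section Distortion

variable {U V : Type*} [MetricSpace U] [MetricSpace V]

theorem exists_lipschitz_of_distortion_lt [Nontrivial U] {α : ℝ} {f : U → V}
    (hf : distortion f < ENNReal.ofReal α) : ∃ A B : ℝ, 0 ≤ A ∧ 0 ≤ B ∧ A * B < α ∧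
      (∀ x y, dist (f x) (f y) ≤ A * dist x y) ∧ ∀ x y, dist x y ≤ B * dist (f x) (f y) := by
  rw [distortion] at hf
  split_ifs at hf with hinj
  swap
  · simp at hf
  set S := ⨆ (x : U) (y : U) (_ : x ≠ y), edist (f x) (f y) / edist x y with hS
  set T := ⨆ (a : U) (b : U) (_ : a ≠ b), edist a b / edist (f a) (f b) with hT
  have hSle : ∀ x y, x ≠ y → edist (f x) (f y) / edist x y ≤ S := fun x y h =>
    le_iSup_of_le x (le_iSup_of_le y (le_iSup_of_le h le_rfl))
  have hTle : ∀ x y, x ≠ y → edist x y / edist (f x) (f y) ≤ T := fun x y h =>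
    le_iSup_of_le x (le_iSup_of_le y (le_iSup_of_le h le_rfl))
  obtain ⟨a, b, hab⟩ := exists_pair_ne U
  have hfab : f a ≠ f b := hinj.ne hab
  -- Both suprema are nonzero, so finiteness of the product forces each to be finite.
  have hS0 : S ≠ 0 := fun h => by
    have := hSle a b hab
    rw [h, nonpos_iff_eq_zero, ENNReal.div_eq_zero_iff] at this
    simp [hfab, edist_ne_top] at this
  have hT0 : T ≠ 0 := fun h => by
    have := hTle a b hab
    rw [h, nonpos_iff_eq_zero, ENNReal.div_eq_zero_iff] at this
    simp [hab, edist_ne_top] at this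
  have hST : S * T ≠ ∞ := (hf.trans ENNReal.ofReal_lt_top).ne
  have hS1 : S ≠ ∞ := fun h => hST (by rw [h, ENNReal.top_mul hT0])
  have hT1 : T ≠ ∞ := fun h => hST (by rw [h, ENNReal.mul_top hS0])
  refine ⟨S.toReal, T.toReal, ENNReal.toReal_nonneg, ENNReal.toReal_nonneg, ?_, fun x y => ?_,
    fun x y => ?_⟩
  · rw [← ENNReal.toReal_mul]
    exact (ENNReal.lt_ofReal_iff_toReal_lt hST).1 hf
  · rcases eq_or_ne x y with rfl | h
    · simp
    have := (ENNReal.div_le_iff (edist_pos.2 h).ne' (edist_ne_top x y)).1 (hSle x y h)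
    rw [dist_edist, dist_edist, ← ENNReal.toReal_mul]
    exact ENNReal.toReal_mono (ENNReal.mul_ne_top hS1 (edist_ne_top _ _)) this
  · rcases eq_or_ne x y with rfl | h
    · simp
    have := (ENNReal.div_le_iff (edist_pos.2 (hinj.ne h)).ne' (edist_ne_top _ _)).1 (hTle x y h)
    rw [dist_edist, dist_edist, ← ENNReal.toReal_mul]
    exact ENNReal.toReal_mono (ENNReal.mul_ne_top hT1 (edist_ne_top _ _)) this

theorem distortion_le_ofReal {A : ℝ} {f : U → V}
    (hA : ∀ x y, dist (f x) (f y) ≤ A * dist x y) (hB : ∀ x y, dist x y ≤ dist (f x) (f y)) :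
    distortion f ≤ ENNReal.ofReal A := by
  have hinj : Function.Injective f := fun x y h => by
    have := hB x y
    rw [h, dist_self] at this
    exact dist_le_zero.1 this
  rw [distortion, if_pos hinj]
  rw [← mul_one (ENNReal.ofReal A)]
  refine mul_le_mul' ?_ ?_
  · refine iSup_le fun x => iSup_le fun y => iSup_le fun h => ENNReal.div_le_of_le_mul ?_
    rw [edist_dist, edist_dist, ← ENNReal.ofReal_mul' dist_nonneg]
    exact ENNReal.ofReal_le_ofReal (hA x y)
  · refine iSup_le fun x => iSup_le fun y => iSup_le fun h => ENNReal.div_le_of_le_mul ?_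
    rw [one_mul, edist_dist, edist_dist]
    exact ENNReal.ofReal_le_ofReal (hB x y)

end Distortion

/-! ### Bounds for grids in `ℓ_p` -/

section GridInEllp

theorem nontrivial_linftyGrid {m n : ℕ} (hm : 2 ≤ m) (hn : 1 ≤ n) :
    Nontrivial (linftyGrid m n) := by
  refine ⟨⟨fun _ => 1, fun _ => ⟨1, le_rfl, by omega, by simp⟩⟩,
    ⟨fun _ => 2, fun _ => ⟨2, by omega, hm, by simp⟩⟩, fun h => ?_⟩
  have := congrFun (congrArg Subtype.val h) ⟨0, hn⟩
  norm_num at this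

theorem log_le_of_ellpDistortion_lt {p α : ℝ} (hp : 2 ≤ p) {m n : ℕ} (hα : 1 ≤ α)
    (hn : 1 ≤ n) (hm : 34 * α ≤ m)
    (h : ellpDistortion p hp (linftyGrid m n) < ENNReal.ofReal α) :
    Real.log n ≤ p * Real.log (16 * α) := by
  have : Fact (1 ≤ ENNReal.ofReal p) := ⟨one_le_ofReal_of_two_le hp⟩
  have hm34 : 34 ≤ m := by exact_mod_cast (show (34 : ℝ) ≤ m by linarith)
  have := nontrivial_linftyGrid (m := m) (n := n) (by omega) hn
  obtain ⟨f, hf⟩ := iInf_lt_iff.1 h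
  obtain ⟨A, B, hA, hB, hAB, hfA, hfB⟩ := exists_lipschitz_of_distortion_lt hf
  obtain ⟨k, hk⟩ : ∃ k, k = (m - 1) / 2 := ⟨_, rfl⟩
  have hkm : 2 * k + 1 ≤ m := by omega
  have hmk : (m : ℝ) ≤ 2 * k + 2 := by exact_mod_cast (by omega : m ≤ 2 * k + 2)
  -- From `34α ≤ 2k + 2` one gets `k ≥ 17α - 1`, and `α ≥ 1`.
  have hkα : 16 * α ≤ k := by linarith
  have hp0 : 0 ≤ p := by linarith
  have key := grid_rpow_le (k := k) (by linarith) (lp_clarkson hp) (by omega) hkm hA hB f hfA hfB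
  have hn0 : (0 : ℝ) < n := by exact_mod_cast hn
  have h₁ : (8 * (A * B)) ^ p ≤ (8 * α) ^ p :=
    Real.rpow_le_rpow (by positivity) (by linarith) hp0
  have htwo : (2 : ℝ) ≤ 2 ^ p := Real.self_le_rpow_of_one_le one_le_two (by linarith)
  have h₂ : 2 * (8 * α) ^ p ≤ (16 * α) ^ p := by
    rw [show 16 * α = 2 * (8 * α) by ring,
      Real.mul_rpow (x := 2) (y := 8 * α) (by norm_num) (by positivity)]
    exact mul_le_mul_of_nonneg_right htwo (by positivity)
  have h₃ : (16 * α) ^ p ≤ (k : ℝ) ^ p := Real.rpow_le_rpow (by positivity) hkα hp0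
  have hkp : 0 < (k : ℝ) ^ p := Real.rpow_pos_of_pos (by linarith) p
  have h₄ : n * (k : ℝ) ^ p ≤ (8 * α) ^ p * (n + (k : ℝ) ^ p) :=
    key.trans (by gcongr)
  -- The term `(8α)^p n` is at most half of the left side of `h₄`.
  have h₅ : n * (2 * (8 * α) ^ p) ≤ n * (k : ℝ) ^ p := by
    gcongr
    exact h₂.trans h₃
  have h₆ : n * (k : ℝ) ^ p ≤ (16 * α) ^ p * (k : ℝ) ^ p :=
    le_trans (by linarith) (mul_le_mul_of_nonneg_right h₂ hkp.le)
  have h₇ : (n : ℝ) ≤ (16 * α) ^ p := le_of_mul_le_mul_right h₆ hkp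
  rw [← Real.log_rpow (by positivity)]
  exact Real.log_le_log hn0 h₇

/-- Extension by zero of a vector of `ℝⁿ` to an element of `ℓ_p`. -/
noncomputable def toEllp (p : ℝ≥0∞) {n : ℕ} (x : Fin n → ℝ) : lp (fun _ : ℕ => ℝ) p :=
  ∑ i : Fin n, lp.single p (i : ℕ) (x i)

theorem norm_toEllp_sub_rpow {p : ℝ} (hp : 0 < p) {n : ℕ} (x y : Fin n → ℝ) :
    ‖toEllp (ENNReal.ofReal p) x - toEllp (ENNReal.ofReal p) y‖ ^ p = ∑ i, |x i - y i| ^ p := by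
  have ht : (ENNReal.ofReal p).toReal = p := ENNReal.toReal_ofReal hp.le
  have hpos : 0 < (ENNReal.ofReal p).toReal := by rwa [ht]
  set z : ℕ → ℝ := fun j => if h : j < n then x ⟨j, h⟩ - y ⟨j, h⟩ else 0 with hz
  have hzi : ∀ i : Fin n, z i = x i - y i := fun i => by simp [hz]
  have hsum : toEllp (ENNReal.ofReal p) x - toEllp (ENNReal.ofReal p) y =
      ∑ j ∈ Finset.range n, lp.single (ENNReal.ofReal p) j (z j) := by
    rw [toEllp, toEllp, ← Finset.sum_sub_distrib, Finset.sum_range]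
    refine Finset.sum_congr rfl fun i _ => ?_
    rw [hzi, lp.single_sub]
  have := lp.norm_sum_single hpos z (Finset.range n)
  rw [ht] at this
  rw [hsum, this, Finset.sum_range]
  exact Finset.sum_congr rfl fun i _ => by rw [hzi, Real.norm_eq_abs]

theorem ellpDistortion_linftyGrid_le {p : ℝ} (hp : 2 ≤ p) (m n : ℕ) :
    ellpDistortion p hp (linftyGrid m n) ≤ ENNReal.ofReal ((n : ℝ) ^ p⁻¹) := by
  have : Fact (1 ≤ ENNReal.ofReal p) := ⟨one_le_ofReal_of_two_le hp⟩
  have hp0 : 0 < p := by linarith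
  refine iInf_le_of_le (fun x => toEllp _ x.1) (distortion_le_ofReal (fun x y => ?_) fun x y => ?_)
  · rw [dist_eq_norm, ← Real.rpow_le_rpow_iff (norm_nonneg _) (by positivity) hp0,
      norm_toEllp_sub_rpow hp0, Real.mul_rpow (by positivity) dist_nonneg,
      Real.rpow_inv_rpow (by positivity) hp0.ne']
    refine (Finset.sum_le_sum fun i _ => Real.rpow_le_rpow (abs_nonneg _)
      (dist_le_pi_dist x.1 y.1 i) hp0.le).trans_eq ?_
    simp [Subtype.dist_eq]
  · rw [Subtype.dist_eq, dist_pi_le_iff dist_nonneg]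
    intro i
    rw [dist_eq_norm (toEllp _ _), ← Real.rpow_le_rpow_iff dist_nonneg (norm_nonneg _) hp0,
      norm_toEllp_sub_rpow hp0]
    exact Finset.single_le_sum (f := fun i => |x.1 i - y.1 i| ^ p)
      (fun j _ => Real.rpow_nonneg (abs_nonneg _) _) (Finset.mem_univ i)

theorem pIndex_linftyGrid_bounds {α : ℝ} {m n : ℕ} (hα : 2 ≤ α) (hn : 1 ≤ n)
    (hm : 34 * α ≤ m) :
    1 / 5 * max 1 (Real.log n / Real.log α) ≤ pIndex α (linftyGrid m n) ∧
      pIndex α (linftyGrid m n) ≤ 2 * max 1 (Real.log n / Real.log α) := by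
  have hlog : 0 < Real.log α := Real.log_pos (by linarith)
  set M := max 1 (Real.log n / Real.log α) with hM
  have hM1 : 1 ≤ M := le_max_left _ _
  -- The factor 2 gives both `p ≥ 2` and the strict inequality `n^(1/p) < α`.
  have hmem : 2 * M ∈ {p : ℝ | ∃ hp : 2 ≤ p,
      ellpDistortion p hp (linftyGrid m n) < ENNReal.ofReal α} := by
    refine ⟨by linarith, (ellpDistortion_linftyGrid_le _ m n).trans_lt ?_⟩
    have hn0 : (0 : ℝ) < n := by exact_mod_cast hn
    rw [ENNReal.ofReal_lt_ofReal_iff (by linarith), ← Real.log_lt_log_iff (by positivity)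
      (by linarith), Real.log_rpow hn0, inv_mul_lt_iff₀ (by linarith)]
    have : Real.log n ≤ M * Real.log α := (div_le_iff₀ hlog).1 (le_max_right _ _)
    nlinarith
  refine ⟨le_csInf ⟨_, hmem⟩ ?_, csInf_le ⟨2, fun p hp => hp.1⟩ hmem⟩
  rintro p ⟨hp, hlt⟩
  have h := log_le_of_ellpDistortion_lt hp (by linarith) hn hm hlt
  -- Since `α ≥ 2`, `16 ≤ α^4`; this is the source of the constant `1/5`.
  have h16 : Real.log (16 * α) ≤ 5 * Real.log α := by
    rw [← Real.log_rpow (by linarith)]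
    refine Real.log_le_log (by linarith) ?_
    have : (16 : ℝ) ≤ α ^ 4 := by
      calc (16 : ℝ) = 2 ^ 4 := by norm_num
        _ ≤ α ^ 4 := by gcongr
    calc 16 * α ≤ α ^ 4 * α := by gcongr
      _ = α ^ (5 : ℝ) := by
        rw [← pow_succ]
        exact_mod_cast rfl
  have hd : Real.log n / Real.log α ≤ 5 * p := by
    rw [div_le_iff₀ hlog]
    nlinarith
  have : M ≤ 5 * p := max_le (by linarith) hd
  linarith

end GridInEllp

/-! ### The three assertions -/

theorem corollary1p9 :
    -- `p([m]_∞^n) ≍ log n`, where `p = p_10`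
    (∃ m₀ : ℕ, ∃ c K : ℝ, 0 < c ∧ 0 < K ∧ ∀ m n : ℕ, m₀ ≤ m → 2 ≤ n →
      c * Real.log n ≤ pIndex 10 (linftyGrid m n) ∧
      pIndex 10 (linftyGrid m n) ≤ K * Real.log n) ∧
    -- `p_α([m]_∞^n) ≍ max {1, log n / log α}`, which is `log n / log α` if `n ≥ α`
    (∃ C c K : ℝ, 1 ≤ C ∧ 0 < c ∧ 0 < K ∧
      ∀ (α : ℝ) (m n : ℕ), 2 ≤ α → 1 ≤ n → C * α ≤ m →
        (c * max 1 (Real.log n / Real.log α) ≤ pIndex α (linftyGrid m n) ∧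
          pIndex α (linftyGrid m n) ≤ K * max 1 (Real.log n / Real.log α)) ∧
        (α ≤ n →
          c * (Real.log n / Real.log α) ≤ pIndex α (linftyGrid m n) ∧
          pIndex α (linftyGrid m n) ≤ K * (Real.log n / Real.log α))) ∧
    -- the discretized Ribe-type statement, with `m` depending only on the distortion bound
    (∀ D : ℝ, 1 ≤ D → ∃ m₁ : ℕ, ∃ c : ℝ, 0 < c ∧
      ∀ (m n : ℕ) (p : ℝ) (hp : 2 ≤ p), m₁ ≤ m → 1 ≤ n →
        ellpDistortion p hp (linftyGrid m n) ≤ ENNReal.ofReal D → c * Real.log n ≤ p) := by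
  refine ⟨?_, ?_, fun D hD => ?_⟩
  · refine ⟨340, 1 / (5 * Real.log 10), 2 / Real.log 2, ?_, ?_, fun m n hm hn => ?_⟩
    · have := Real.log_pos (show (1 : ℝ) < 10 by norm_num)
      positivity
    · have := Real.log_pos (show (1 : ℝ) < 2 by norm_num)
      positivity
    have hm' : (34 * 10 : ℝ) ≤ m := by
      have : (340 : ℝ) ≤ m := by exact_mod_cast hm
      linarith
    obtain ⟨h₁, h₂⟩ := pIndex_linftyGrid_bounds (n := n) (by norm_num) (by omega) hm'
    have hl2 : 0 < Real.log 2 := Real.log_pos (by norm_num)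
    have hln : Real.log 2 ≤ Real.log n := Real.log_le_log (by norm_num) (by exact_mod_cast hn)
    have hlow := le_max_right 1 (Real.log n / Real.log 10)
    have hupp : max 1 (Real.log n / Real.log 10) ≤ Real.log n / Real.log 2 :=
      max_le ((one_le_div hl2).2 hln) (by gcongr; norm_num)
    constructor
    · calc 1 / (5 * Real.log 10) * Real.log n = 1 / 5 * (Real.log n / Real.log 10) := by
            field_simp
        _ ≤ _ := by linarith
    · calc _ ≤ 2 * (Real.log n / Real.log 2) := by linarith
        _ = _ := by ring
  · refine ⟨34, 1 / 5, 2, by norm_num, by norm_num, by norm_num, fun α m n hα hn hm => ?_⟩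
    have h := pIndex_linftyGrid_bounds hα hn hm
    refine ⟨h, fun hαn => ?_⟩
    have hone : 1 ≤ Real.log n / Real.log α :=
      (one_le_div (Real.log_pos (by linarith))).2 (Real.log_le_log (by linarith) hαn)
    rwa [max_eq_right hone] at h
  · have hlog : 0 < Real.log (16 * (D + 1)) := Real.log_pos (by linarith)
    refine ⟨⌈34 * (D + 1)⌉₊, 1 / Real.log (16 * (D + 1)), by positivity,
      fun m n p hp hm hn h => ?_⟩
    -- The infimum need not be attained, so `D + 1` provides a strict bound.
    have hlt : ENNReal.ofReal D < ENNReal.ofReal (D + 1) :=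
      (ENNReal.ofReal_lt_ofReal_iff (by linarith)).2 (by linarith)
    have := log_le_of_ellpDistortion_lt hp (by linarith) hn (Nat.ceil_le.1 hm) (h.trans_lt hlt)
    rw [one_div, inv_mul_le_iff₀ hlog]
    linarith
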